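/- All graphs are finite and simple. For positive integers $n,d$ with $n\ge 2d$, let $K_{n/d}$ be the graph on $\{0,1,\dots,n-1\}$ in which $i$ and $j$ are adjacent if and only if $d\le|i-j|\le n-d$, and let $$\chi_c(G)=\inf\{\,n/d : n\ge 2d\ge 2 \text{ and there is a graph homomorphism } G\to K_{n/d}\,\}$$ be the circular chromatic number of $G$. For a graph $G$ and positive integers $p,q$, let $G^{1/q}$ be the graph obtained from $G$ by replacing every edge by a path with $q$ edges, let $G^{p}$ be the graph on $V(G)$ in which two distinct vertices are adjacent if and only if they are joined by a walk of length exactly $p$ in $G$, and let $G^{p/q}=(G^{1/q})^{p}$. Let $r,s$ be non-negative integers and let $G$ be a non-bipartite graph. If $$\frac{2r+1}{2s+1}\le\frac{\chi_c(G)}{3(\chi_c(G)-2)},$$ then $$\chi_c\bigl(G^{(2r+1)/(2s+1)}\bigr)=\frac{(2s+1)\,\chi_c(G)}{(s-r)\,\chi_c(G)+2r+1}.$$ -/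

import Mathlib

namespace FracPow

/-- The circular complete graph `K_{n/d}` on `{0, …, n-1}`: `i` and `j` are adjacent iff
`d ≤ |i - j| ≤ n - d`. (The condition `i ≠ j` is automatic as soon as `d` is positive, which
is the only case used.) -/
def circularComplete (n d : ℕ) : SimpleGraph (Fin n) where
  Adj i j := i ≠ j ∧ (d : ℤ) ≤ |(i : ℤ) - (j : ℤ)| ∧ |(i : ℤ) - (j : ℤ)| ≤ (n : ℤ) - (d : ℤ)
  symm := ⟨fun i j h => ⟨h.1.symm, by rw [abs_sub_comm]; exact h.2⟩⟩
  loopless := ⟨fun _ h => h.1 rfl⟩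

/-- The circular chromatic number: the infimum of `n / d` over all positive integers `n, d` with
`2d ≤ n` such that `G` has a homomorphism to `K_{n/d}`. -/
noncomputable def circularChromaticNumber {V : Type*} (G : SimpleGraph V) : ℝ :=
  sInf {x : ℝ | ∃ n d : ℕ, 0 < d ∧ 2 * d ≤ n ∧
    Nonempty (G →g circularComplete n d) ∧ x = (n : ℝ) / (d : ℝ)}

/-- The `k`th power of `G`: two distinct vertices are adjacent iff they are joined by a walk of
length exactly `k` in `G`. -/
def power {V : Type*} (G : SimpleGraph V) (k : ℕ) : SimpleGraph V where
  Adj u v := u ≠ v ∧ ∃ p : G.Walk u v, p.length = k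
  symm := ⟨fun _ _ h => ⟨h.1.symm, h.2.elim fun p hp => ⟨p.reverse, by simpa using hp⟩⟩⟩
  loopless := ⟨fun _ h => h.1 rfl⟩

/-- The vertices of the `s`-subdivision: the vertices of `G`, and `s - 1` new vertices for
every edge of `G`. -/
abbrev SubdivVertex {V : Type*} (G : SimpleGraph V) (s : ℕ) : Type _ :=
  V ⊕ (G.edgeSet × Fin (s - 1))

/-- The `i`th vertex (`0 ≤ i ≤ s`) of the path with `s` edges that replaces the edge `e`. The path
runs from one endpoint of `e` to the other, in an arbitrarily chosen direction. -/
noncomputable def pathVertex {V : Type*} (G : SimpleGraph V) (s : ℕ) (e : G.edgeSet) (i : ℕ) :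
    SubdivVertex G s :=
  if h0 : i = 0 then Sum.inl (Quot.out e.1).1
  else if h : i < s then Sum.inr (e, ⟨i - 1, by omega⟩)
  else Sum.inl (Quot.out e.1).2

/-- The graph `G^{1/s}` (for `s ≥ 1`): every edge of `G` is replaced by a path with `s` edges. -/
noncomputable def subdivision {V : Type*} (G : SimpleGraph V) (s : ℕ) :
    SimpleGraph (SubdivVertex G s) :=
  SimpleGraph.fromRel fun x y =>
    ∃ (e : G.edgeSet) (i : ℕ), i < s ∧ x = pathVertex G s e i ∧ y = pathVertex G s e (i + 1)

/-- The fractional power `G^{r/s} = (G^{1/s})^r`. -/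
noncomputable def fracPower {V : Type*} (G : SimpleGraph V) (r s : ℕ) :
    SimpleGraph (SubdivVertex G s) :=
  power (subdivision G s) r

end FracPow

/-! ### Circular colourings by points of ℝ/ℤ -/

namespace FracPow

open SimpleGraph

/-! The infimum of the errors `δ` with `CircColorable G δ` is `D(G) = 1/2 - 1/χ_c(G)`, and `D`
scales: `D(G^{a/b}) = (a/b) D(G)` for odd `a`, `b` when the right side is at most 1/6. Solving for
`χ_c` gives the formula. Errors add up along walks, so an odd power multiplies `δ` by at most its
exponent, and an odd subdivision can share an edge's error evenly among its pieces. The converse for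
subdivisions is again addition along a path. The hard step is the converse for powers,
`CircColorable.of_power`. Given a colouring of the power with error ε < 1/4, lift the edge errors to
reals. Every walk of length 2r+1 then has total error at most ε, so closed walks have mean error at
most ε/(2r+1), and a shortest-path potential corrects the colouring to that error on every edge. -/

/-- A colouring of the vertices by points of the circle `ℝ / ℤ` such that adjacent vertices get
colours that are antipodal up to an error of at most `δ`. -/
def CircColorable {V : Type*} (G : SimpleGraph V) (δ : ℝ) : Prop :=
  ∃ φ : V → ℝ, ∀ u v, G.Adj u v → ∃ k : ℤ, |φ v - φ u - 1 / 2 - k| ≤ δ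

theorem CircColorable.mono {V : Type*} {G : SimpleGraph V} {δ ε : ℝ} (h : CircColorable G δ)
    (hδ : δ ≤ ε) : CircColorable G ε := by
  obtain ⟨φ, hφ⟩ := h
  exact ⟨φ, fun u v huv => (hφ u v huv).imp fun k hk => hk.trans hδ⟩

theorem antipodal_symm {x y δ : ℝ} (h : ∃ k : ℤ, |y - x - 1 / 2 - k| ≤ δ) :
    ∃ k : ℤ, |x - y - 1 / 2 - k| ≤ δ := by
  obtain ⟨k, hk⟩ := h
  refine ⟨-k - 1, ?_⟩
  rw [abs_le] at hk ⊢
  push_cast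
  constructor <;> linarith [hk.1, hk.2]

theorem circColorable_of_hom {V : Type*} {G : SimpleGraph V} {n d : ℕ} (hd : 0 < d)
    (hn : 2 * d ≤ n) (f : G →g circularComplete n d) :
    CircColorable G (1 / 2 - (d : ℝ) / n) := by
  have hn0 : (0 : ℝ) < n := by exact_mod_cast (by omega : 0 < n)
  refine ⟨fun v => ((f v : ℕ) : ℝ) / n, fun u v huv => ?_⟩
  obtain ⟨-, h1, h2⟩ := f.map_rel huv
  have h1' : (d : ℝ) ≤ |((f u : ℕ) : ℝ) - ((f v : ℕ) : ℝ)| := by exact_mod_cast h1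
  have h2' : |((f u : ℕ) : ℝ) - ((f v : ℕ) : ℝ)| ≤ (n : ℝ) - d := by exact_mod_cast h2
  set x : ℝ := ((f u : ℕ) : ℝ)
  set y : ℝ := ((f v : ℕ) : ℝ)
  have e1 : (d : ℝ) / n ≤ |x - y| / n := by gcongr
  have e2 : |x - y| / n ≤ 1 - (d : ℝ) / n := by
    rw [div_le_iff₀ hn0, sub_mul, div_mul_cancel₀ _ hn0.ne']; linarith
  rcases le_total y x with hxy | hxy
  · rw [abs_of_nonneg (by linarith), sub_div] at e1 e2
    refine ⟨-1, ?_⟩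
    rw [abs_le]; push_cast
    constructor <;> linarith
  · rw [abs_of_nonpos (by linarith), neg_sub, sub_div] at e1 e2
    refine ⟨0, ?_⟩
    rw [abs_le]; push_cast
    constructor <;> linarith

/-- The set of which the circular chromatic number is the infimum. -/
abbrev circularRatios {V : Type*} (G : SimpleGraph V) : Set ℝ :=
  {x : ℝ | ∃ n d : ℕ, 0 < d ∧ 2 * d ≤ n ∧
    Nonempty (G →g circularComplete n d) ∧ x = (n : ℝ) / (d : ℝ)}

theorem two_le_of_mem_circularRatios {V : Type*} {G : SimpleGraph V} {x : ℝ}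
    (hx : x ∈ circularRatios G) : 2 ≤ x := by
  obtain ⟨n, d, hd, hn, -, rfl⟩ := hx
  rw [le_div_iff₀ (by exact_mod_cast hd)]
  exact_mod_cast hn

theorem bddBelow_circularRatios {V : Type*} (G : SimpleGraph V) : BddBelow (circularRatios G) :=
  ⟨2, fun _ => two_le_of_mem_circularRatios⟩

theorem antipodal_fract {x y δ : ℝ} (hδ : δ < 1 / 2) (h : ∃ k : ℤ, |y - x - 1 / 2 - k| ≤ δ) :
    1 / 2 - δ ≤ |Int.fract x - Int.fract y| ∧ |Int.fract x - Int.fract y| ≤ 1 / 2 + δ := by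
  obtain ⟨k, hk⟩ := h
  have hx := Int.floor_add_fract x
  have hy := Int.floor_add_fract y
  have hx0 := Int.fract_nonneg x
  have hy0 := Int.fract_nonneg y
  have hx1 := Int.fract_lt_one x
  have hy1 := Int.fract_lt_one y
  rw [abs_le] at hk
  obtain ⟨m, hm⟩ : ∃ m : ℤ, m = k + ⌊x⌋ - ⌊y⌋ := ⟨_, rfl⟩
  have hm' : (m : ℝ) = k + ⌊x⌋ - ⌊y⌋ := by rw [hm]; push_cast; ring
  have l1 : (-2 : ℝ) < m := by linarith
  have l2 : (m : ℝ) < 1 := by linarith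
  have l1' : (-2 : ℤ) < m := by exact_mod_cast l1
  have l2' : m < 1 := by exact_mod_cast l2
  obtain rfl | rfl : m = -1 ∨ m = 0 := by omega
  · push_cast at hm'
    rw [abs_of_nonneg (by linarith)]
    constructor <;> linarith
  · push_cast at hm'
    rw [abs_of_nonpos (by linarith)]
    constructor <;> linarith

/-- Cut the circle into `n` equal arcs and round down. A difference changes by less than one arc,
hence the `- 1` after the ceiling. -/
theorem CircColorable.exists_hom {V : Type*} {G : SimpleGraph V} {δ : ℝ} (h : CircColorable G δ)
    (hδ : δ < 1 / 2) (n : ℕ) (hn : 1 < n * (1 / 2 - δ)) :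
    Nonempty (G →g circularComplete n (⌈n * (1 / 2 - δ)⌉₊ - 1)) := by
  obtain ⟨φ, hφ⟩ := h
  have hn0 : (0 : ℝ) < n := by
    rcases Nat.eq_zero_or_pos n with rfl | h0
    · norm_num at hn
    · exact_mod_cast h0
  have hlt : ∀ v, ⌊n * Int.fract (φ v)⌋₊ < n := fun v => by
    have h0 : (0 : ℝ) ≤ n * Int.fract (φ v) := mul_nonneg hn0.le (Int.fract_nonneg _)
    rw [Nat.floor_lt h0]
    nlinarith [Int.fract_lt_one (φ v)]
  have hc : (1 : ℝ) < ⌈n * (1 / 2 - δ)⌉₊ := hn.trans_le (Nat.le_ceil _)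
  have hc' : 1 < ⌈n * (1 / 2 - δ)⌉₊ := by exact_mod_cast hc
  have hc2 := Nat.ceil_lt_add_one (by linarith : (0 : ℝ) ≤ n * (1 / 2 - δ))
  refine ⟨⟨fun v => ⟨_, hlt v⟩, fun {u v} huv => ?_⟩⟩
  obtain ⟨h1, h2⟩ := antipodal_fract hδ (hφ u v huv)
  set x := Int.fract (φ u)
  set y := Int.fract (φ v)
  have x0 : (0 : ℝ) ≤ n * x := mul_nonneg hn0.le (Int.fract_nonneg _)
  have y0 : (0 : ℝ) ≤ n * y := mul_nonneg hn0.le (Int.fract_nonneg _)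
  have fx := Nat.floor_le x0
  have fy := Nat.floor_le y0
  have gx := Nat.lt_floor_add_one (n * x)
  have gy := Nat.lt_floor_add_one (n * y)
  have key : ∀ i j : ℕ, ∀ a b : ℝ, (i : ℝ) ≤ n * a → n * a < i + 1 → (j : ℝ) ≤ n * b →
      n * b < j + 1 → 1 / 2 - δ ≤ a - b → a - b ≤ 1 / 2 + δ →
      (((⌈n * (1 / 2 - δ)⌉₊ - 1 : ℕ) : ℤ) ≤ (i : ℤ) - j) ∧
      ((i : ℤ) - j ≤ (n : ℤ) - ((⌈n * (1 / 2 - δ)⌉₊ - 1 : ℕ) : ℤ)) := by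
    intro i j a b ha ha' hb hb' hab hab'
    have m1 := mul_le_mul_of_nonneg_left hab hn0.le
    have m2 := mul_le_mul_of_nonneg_left hab' hn0.le
    have l1 : (⌈n * (1 / 2 - δ)⌉₊ : ℝ) < (i : ℝ) - j + 2 := by linarith
    have l2 : (⌈n * (1 / 2 - δ)⌉₊ : ℝ) < (n : ℝ) - (i - j) + 2 := by linarith
    have l1' : ((⌈n * (1 / 2 - δ)⌉₊ : ℕ) : ℤ) < (i : ℤ) - j + 2 := by exact_mod_cast l1
    have l2' : ((⌈n * (1 / 2 - δ)⌉₊ : ℕ) : ℤ) < (n : ℤ) - (i - j) + 2 := by exact_mod_cast l2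
    omega
  have main : (((⌈n * (1 / 2 - δ)⌉₊ - 1 : ℕ) : ℤ) ≤
        |((⌊n * x⌋₊ : ℕ) : ℤ) - ((⌊n * y⌋₊ : ℕ) : ℤ)|) ∧
      (|((⌊n * x⌋₊ : ℕ) : ℤ) - ((⌊n * y⌋₊ : ℕ) : ℤ)| ≤
        (n : ℤ) - ((⌈n * (1 / 2 - δ)⌉₊ - 1 : ℕ) : ℤ)) := by
    rcases le_total y x with hxy | hxy
    · rw [abs_of_nonneg (by linarith)] at h1 h2
      obtain ⟨k1, k2⟩ := key _ _ x y fx gx fy gy h1 h2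
      rw [abs_of_nonneg (by omega)]
      exact ⟨k1, k2⟩
    · rw [abs_of_nonpos (by linarith), neg_sub] at h1 h2
      obtain ⟨k1, k2⟩ := key _ _ y x fy gy fx gx h1 h2
      rw [abs_of_nonpos (by omega), neg_sub]
      exact ⟨k1, k2⟩
  refine ⟨fun hEq => ?_, main⟩
  have hEq' : ⌊n * x⌋₊ = ⌊n * y⌋₊ := congrArg Fin.val hEq
  have := main.1
  rw [hEq', sub_self, abs_zero] at this
  omega

theorem CircColorable.exists_mem_circularRatios {V : Type*} {G : SimpleGraph V} {δ : ℝ}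
    (h : CircColorable G δ) (h0 : 0 ≤ δ) (hδ : δ < 1 / 2) {ε : ℝ} (hε : 0 < ε) :
    ∃ x ∈ circularRatios G, 1 / 2 - δ - ε ≤ 1 / x := by
  obtain ⟨n, hn⟩ := exists_nat_gt (1 / (1 / 2 - δ) + 1 / ε)
  have ht : 0 < 1 / 2 - δ := by linarith
  have hi1 : 0 < 1 / (1 / 2 - δ) := by positivity
  have hi2 : 0 < 1 / ε := by positivity
  have h1 : 1 / (1 / 2 - δ) < n := by linarith
  have h2 : 1 / ε < n := by linarith
  have hn0 : (0 : ℝ) < n := by linarith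
  rw [div_lt_iff₀ ht] at h1
  rw [div_lt_iff₀ hε] at h2
  have hc : (1 : ℝ) < ⌈n * (1 / 2 - δ)⌉₊ := h1.trans_le (Nat.le_ceil _)
  have hc' : 1 < ⌈n * (1 / 2 - δ)⌉₊ := by exact_mod_cast hc
  have hc2 := Nat.ceil_lt_add_one (by linarith : (0 : ℝ) ≤ n * (1 / 2 - δ))
  have hc3 := Nat.le_ceil (n * (1 / 2 - δ))
  obtain ⟨d, hd⟩ : ∃ d, ⌈n * (1 / 2 - δ)⌉₊ = d + 1 :=
    ⟨⌈n * (1 / 2 - δ)⌉₊ - 1, by omega⟩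
  have hom := h.exists_hom hδ n h1
  rw [hd] at hom hc' hc2 hc3
  push_cast at hc2 hc3
  refine ⟨(n : ℝ) / d, ⟨n, d, by omega, ?_, hom, rfl⟩, ?_⟩
  · have : (2 * d : ℝ) ≤ n := by nlinarith
    exact_mod_cast this
  · rw [one_div_div, le_div_iff₀ hn0]
    nlinarith

theorem CircColorable.le_one_div {V : Type*} {G : SimpleGraph V} {δ : ℝ}
    (h : CircColorable G δ) (h0 : 0 ≤ δ) : 1 / 2 - δ ≤ 1 / circularChromaticNumber G := by
  rcases lt_or_ge δ (1 / 2) with hδ | hδ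
  · refine le_of_forall_pos_le_add fun ε hε => ?_
    obtain ⟨x, hx, hx'⟩ := h.exists_mem_circularRatios h0 hδ hε
    have hle : circularChromaticNumber G ≤ x := csInf_le (bddBelow_circularRatios G) hx
    have h2 : 2 ≤ circularChromaticNumber G :=
      le_csInf ⟨x, hx⟩ fun _ => two_le_of_mem_circularRatios
    have := one_div_le_one_div_of_le (by linarith) hle
    linarith
  -- The left side is nonpositive here; nonnegativity of `sInf` also covers the empty set, where it
  -- is 0.
  · have : 0 ≤ circularChromaticNumber G :=
      Real.sInf_nonneg fun x hx => by linarith [two_le_of_mem_circularRatios hx]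
    have : 0 ≤ 1 / circularChromaticNumber G := by positivity
    linarith

theorem circularRatios_nonempty {V : Type*} [Finite V] (G : SimpleGraph V) :
    (circularRatios G).Nonempty := by
  obtain ⟨m, ⟨e⟩⟩ := Finite.exists_equiv_fin V
  refine ⟨_, m + 2, 1, one_pos, by omega, ⟨⟨fun v => (e v).castLE (by omega), ?_⟩⟩, rfl⟩
  intro u v huv
  have hne : (e u : ℕ) ≠ e v := fun h => huv.ne (e.injective (Fin.ext h))
  refine ⟨fun h => hne (by simpa using congrArg Fin.val h), ?_, ?_⟩
  · simp only [Fin.val_castLE]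
    have : (e u : ℤ) - (e v : ℤ) ≠ 0 := by omega
    exact_mod_cast Int.one_le_abs this
  · simp only [Fin.val_castLE]
    have := (e u).2
    have := (e v).2
    rw [abs_le]; push_cast; omega

theorem circColorable_of_gt {V : Type*} [Finite V] (G : SimpleGraph V) {δ : ℝ}
    (hδ : 1 / 2 - 1 / circularChromaticNumber G < δ) : CircColorable G δ := by
  have hne := circularRatios_nonempty G
  have h2 : 2 ≤ circularChromaticNumber G := le_csInf hne fun _ => two_le_of_mem_circularRatios
  rcases lt_or_ge δ (1 / 2) with h | h
  · have h1 : circularChromaticNumber G < 1 / (1 / 2 - δ) := by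
      rw [lt_one_div (by linarith) (by linarith)]; linarith
    obtain ⟨x, ⟨n, d, hd, hn, ⟨f⟩, rfl⟩, hx⟩ := exists_lt_of_csInf_lt hne h1
    refine (circColorable_of_hom hd hn f).mono ?_
    have hd0 : (0 : ℝ) < d := by exact_mod_cast hd
    have hn0 : (0 : ℝ) < n := by exact_mod_cast (by omega : 0 < n)
    rw [lt_one_div (by positivity) (by linarith), one_div_div] at hx
    linarith
  · obtain ⟨x, n, d, hd, hn, ⟨f⟩, rfl⟩ := hne
    refine (circColorable_of_hom hd hn f).mono ?_
    have : (0 : ℝ) ≤ (d : ℝ) / n := by positivity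
    linarith

/-! ### Walks and powers -/

theorem antipodal_walk {V : Type*} {H : SimpleGraph V} {δ : ℝ} {φ : V → ℝ}
    (hφ : ∀ u v, H.Adj u v → ∃ k : ℤ, |φ v - φ u - 1 / 2 - k| ≤ δ) {u v : V} (p : H.Walk u v) :
    ∃ k : ℤ, |φ v - φ u - (p.length : ℝ) / 2 - k| ≤ p.length * δ := by
  induction p with
  | nil => exact ⟨0, by simp⟩
  | @cons u v w h p ih =>
    obtain ⟨k, hk⟩ := ih
    obtain ⟨l, hl⟩ := hφ u v h
    refine ⟨k + l, ?_⟩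
    rw [Walk.length_cons]
    push_cast
    rw [abs_le] at hk hl ⊢
    constructor <;> linarith [hk.1, hk.2, hl.1, hl.2]

theorem antipodal_odd_walk {V : Type*} {H : SimpleGraph V} {δ : ℝ} {φ : V → ℝ}
    (hφ : ∀ u v, H.Adj u v → ∃ k : ℤ, |φ v - φ u - 1 / 2 - k| ≤ δ) {u v : V} (p : H.Walk u v)
    {r : ℕ} (hp : p.length = 2 * r + 1) :
    ∃ k : ℤ, |φ v - φ u - 1 / 2 - k| ≤ (2 * r + 1) * δ := by
  obtain ⟨k, hk⟩ := antipodal_walk hφ p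
  refine ⟨k + r, ?_⟩
  rw [hp] at hk
  push_cast at hk ⊢
  convert hk using 2
  ring

theorem CircColorable.power {V : Type*} {H : SimpleGraph V} {δ : ℝ} (h : CircColorable H δ)
    (r : ℕ) : CircColorable (power H (2 * r + 1)) ((2 * r + 1) * δ) := by
  obtain ⟨φ, hφ⟩ := h
  refine ⟨φ, ?_⟩
  rintro u v ⟨-, p, hp⟩
  exact antipodal_odd_walk hφ p hp

/-- A closed odd walk would bring 1/2 within less than 1/2 of an integer. -/
theorem CircColorable.length_ne {V : Type*} {H : SimpleGraph V} {δ : ℝ} (h : CircColorable H δ)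
    {r : ℕ} (hδ : (2 * r + 1) * δ < 1 / 2) {u : V} (p : H.Walk u u) :
    p.length ≠ 2 * r + 1 := by
  intro hp
  obtain ⟨φ, hφ⟩ := h
  obtain ⟨k, hk⟩ := antipodal_odd_walk hφ p hp
  have hk' := hk.trans_lt hδ
  rw [abs_lt] at hk'
  have l1 : (-1 : ℝ) < k := by linarith
  have l2 : (k : ℝ) < 0 := by linarith
  have l1' : -1 < k := by exact_mod_cast l1
  have l2' : k < 0 := by exact_mod_cast l2
  omega

/-- The sum of a weight function on ordered pairs along the darts of a walk. -/
def walkSum {V : Type*} {H : SimpleGraph V} (η : V → V → ℝ) {u v : V} (p : H.Walk u v) : ℝ :=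
  (p.darts.map fun d => η d.fst d.snd).sum

@[simp] theorem walkSum_nil {V : Type*} {H : SimpleGraph V} (η : V → V → ℝ) (u : V) :
    walkSum η (Walk.nil : H.Walk u u) = 0 := by simp [walkSum]

@[simp] theorem walkSum_cons {V : Type*} {H : SimpleGraph V} (η : V → V → ℝ) {u v w : V}
    (h : H.Adj u v) (p : H.Walk v w) : walkSum η (Walk.cons h p) = η u v + walkSum η p := by
  simp [walkSum]

@[simp] theorem walkSum_append {V : Type*} {H : SimpleGraph V} (η : V → V → ℝ) {u v w : V}
    (p : H.Walk u v) (q : H.Walk v w) : walkSum η (p.append q) = walkSum η p + walkSum η q := by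
  simp [walkSum]

theorem walkSum_congr_mod {V : Type*} {H : SimpleGraph V} {ψ : V → ℝ} {η : V → V → ℝ}
    (hη : ∀ u v, ∃ k : ℤ, η u v = ψ v - ψ u - 1 / 2 - k) {u v : V} (p : H.Walk u v) :
    ∃ k : ℤ, walkSum η p = ψ v - ψ u - (p.length : ℝ) / 2 - k := by
  induction p with
  | nil => exact ⟨0, by simp⟩
  | @cons u v w h p ih =>
    obtain ⟨k, hk⟩ := ih
    obtain ⟨l, hl⟩ := hη u v
    refine ⟨k + l, ?_⟩
    rw [walkSum_cons, hk, hl, Walk.length_cons]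
    push_cast
    ring

/-- Go back and forth along the first edge. -/
theorem exists_walk_length_add {V : Type*} {H : SimpleGraph V} {u v : V} (p : H.Walk u v)
    (hp : 0 < p.length) (j : ℕ) : ∃ q : H.Walk u v, q.length = p.length + 2 * j := by
  induction j with
  | zero => exact ⟨p, rfl⟩
  | succ j ih =>
    obtain ⟨q, hq⟩ := ih
    cases q with
    | nil => simp at hq; omega
    | cons h q =>
      refine ⟨Walk.cons h (Walk.cons h.symm (Walk.cons h q)), ?_⟩
      simp only [Walk.length_cons] at hq ⊢
      omega

/-- Two more edges raise the bound from ε to 3ε. Padding the walk to length 2r+1 shows that its sum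
is congruent mod 1 to a number of size at most ε. The two differ by an integer of size at most 4ε <
1, so they are equal. -/
theorem abs_walkSum_le {V : Type*} {H : SimpleGraph V} {ψ : V → ℝ} {η : V → V → ℝ} {ε : ℝ} {r : ℕ}
    (hε : ε < 1 / 4) (hη : ∀ u v, ∃ k : ℤ, η u v = ψ v - ψ u - 1 / 2 - k)
    (hedge : ∀ u v, H.Adj u v → |η u v| ≤ ε)
    (hψ : ∀ u v (p : H.Walk u v), p.length = 2 * r + 1 → ∃ k : ℤ, |ψ v - ψ u - 1 / 2 - k| ≤ ε)
    (j : ℕ) (hj : j ≤ r) {u v : V} (p : H.Walk u v) (hp : p.length = 2 * j + 1) :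
    |walkSum η p| ≤ ε := by
  induction j generalizing u v with
  | zero =>
    cases p with
    | nil => simp at hp
    | cons h p =>
      cases p with
      | nil => simpa using hedge _ _ h
      | cons h' p => simp at hp
  | succ j ih =>
    obtain ⟨q, hq⟩ := exists_walk_length_add p (by omega) (r - (j + 1))
    obtain ⟨k, hk⟩ := hψ u v q (by omega)
    obtain ⟨l, hl⟩ := walkSum_congr_mod hη p
    have h3 : |walkSum η p| ≤ 3 * ε := by
      cases p with
      | nil => simp at hp
      | cons h p =>
        cases p with
        | nil => simp at hp
        | cons h' p =>
          have e1 := hedge _ _ h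
          have e2 := hedge _ _ h'
          have e3 := ih (by omega) p (by simp only [Walk.length_cons] at hp; omega)
          rw [walkSum_cons, walkSum_cons]
          rw [abs_le] at *
          constructor <;> linarith
    rw [hp] at hl
    push_cast at hl
    have hd : ((l + (j + 1) - k : ℤ) : ℝ) = (ψ v - ψ u - 1 / 2 - k) - walkSum η p := by
      rw [hl]; push_cast; ring
    rw [abs_le] at hk h3
    have d1 : ((l + (j + 1) - k : ℤ) : ℝ) < 1 := by rw [hd]; linarith
    have d2 : (-1 : ℝ) < ((l + (j + 1) - k : ℤ) : ℝ) := by rw [hd]; linarith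
    have d1' : l + (j + 1) - k < 1 := by exact_mod_cast d1
    have d2' : -1 < l + (j + 1) - k := by exact_mod_cast d2
    have d0 : l + (j + 1) - k = 0 := by omega
    rw [d0] at hd
    push_cast at hd
    rw [abs_le]
    constructor <;> linarith

theorem exists_append_of_length {V : Type*} {H : SimpleGraph V} (n : ℕ) {m : ℕ} {u v : V}
    (p : H.Walk u v) (hp : p.length = n + m) :
    ∃ (w : V) (q : H.Walk u w) (q' : H.Walk w v),
      q.length = n ∧ q'.length = m ∧ q.append q' = p := by
  induction n generalizing u with
  | zero => exact ⟨u, Walk.nil, p, rfl, by omega, rfl⟩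
  | succ n ih =>
    cases p with
    | nil => simp at hp; omega
    | cons h p =>
      obtain ⟨w, q, q', h1, h2, h3⟩ := ih p (by rw [Walk.length_cons] at hp; omega)
      exact ⟨w, Walk.cons h q, q', by rw [Walk.length_cons, h1], h2, by rw [Walk.cons_append, h3]⟩

theorem abs_walkSum_le_mul {V : Type*} {H : SimpleGraph V} {η : V → V → ℝ} {ε : ℝ} {n : ℕ}
    (h : ∀ u v (p : H.Walk u v), p.length = n → |walkSum η p| ≤ ε) (m : ℕ) {u v : V}
    (p : H.Walk u v) (hp : p.length = m * n) : |walkSum η p| ≤ m * ε := by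
  induction m generalizing u v with
  | zero =>
    cases p with
    | nil => simp
    | cons h p => simp at hp
  | succ m ih =>
    obtain ⟨w, q, q', hq, hq', rfl⟩ :=
      exists_append_of_length n p (hp.trans (by ring : (m + 1) * n = n + m * n))
    have h1 := h _ _ q hq
    have h2 := ih q' hq'
    rw [walkSum_append]
    push_cast
    rw [abs_le] at *
    constructor <;> linarith

theorem exists_closedWalk_iterate {V : Type*} {H : SimpleGraph V} (η : V → V → ℝ) {u : V}
    (p : H.Walk u u) (n : ℕ) :
    ∃ q : H.Walk u u, q.length = n * p.length ∧ walkSum η q = n * walkSum η p := by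
  induction n with
  | zero => exact ⟨Walk.nil, by simp, by simp⟩
  | succ n ih =>
    obtain ⟨q, h1, h2⟩ := ih
    refine ⟨q.append p, ?_, ?_⟩
    · rw [Walk.length_append, h1]; ring
    · rw [walkSum_append, h2]; push_cast; ring

/-- A weight function without negative closed walks has a potential. -/
theorem exists_potential {V : Type*} (H : SimpleGraph V) (w : V → V → ℝ)
    (hw : ∀ u (p : H.Walk u u), 0 ≤ walkSum w p) :
    ∃ π : V → ℝ, ∀ u v, H.Adj u v → π v ≤ π u + w u v := by
  let root : V → V := fun v => (H.connectedComponentMk v).out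
  have hroot : ∀ v, H.Reachable (root v) v := fun v =>
    ConnectedComponent.exact (Quot.out_eq (H.connectedComponentMk v))
  have hbdd : ∀ v, BddBelow (Set.range fun p : H.Walk (root v) v => walkSum w p) := by
    intro v
    -- Closing up with one fixed return walk bounds all walk weights from below.
    obtain ⟨b⟩ := (hroot v).symm
    refine ⟨-walkSum w b, ?_⟩
    rintro _ ⟨p, rfl⟩
    have := hw _ (p.append b)
    rw [walkSum_append] at this
    dsimp only
    linarith
  refine ⟨fun v => ⨅ p : H.Walk (root v) v, walkSum w p, fun u v huv => ?_⟩
  have hr : root v = root u := by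
    simp only [root, ConnectedComponent.connectedComponentMk_eq_of_adj huv]
  dsimp only
  rw [← sub_le_iff_le_add]
  have : Nonempty (H.Walk (root u) u) := hroot u
  refine le_ciInf fun p => ?_
  have := ciInf_le (hbdd v) ((p.append (Walk.cons huv Walk.nil)).copy hr.symm rfl)
  have e : walkSum w ((p.append (Walk.cons huv Walk.nil)).copy hr.symm rfl) =
      walkSum w p + w u v := by
    simp [walkSum]
  rw [e] at this
  linarith

theorem walkSum_add_const {V : Type*} {H : SimpleGraph V} (η : V → V → ℝ) (c : ℝ) {u v : V}
    (p : H.Walk u v) : walkSum (fun x y => c + η x y) p = p.length * c + walkSum η p := by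
  induction p with
  | nil => simp
  | cons h p ih => rw [walkSum_cons, walkSum_cons, ih, Walk.length_cons]; push_cast; ring

theorem CircColorable.of_power {V : Type*} {H : SimpleGraph V} {ε : ℝ} {r : ℕ}
    (h : CircColorable (FracPow.power H (2 * r + 1)) ε) (hε : ε < 1 / 4)
    (hodd : ∀ u (p : H.Walk u u), p.length ≠ 2 * r + 1) :
    CircColorable H (ε / (2 * r + 1)) := by
  obtain ⟨ψ, hψ⟩ := h
  have hψ' : ∀ u v (p : H.Walk u v), p.length = 2 * r + 1 →
      ∃ k : ℤ, |ψ v - ψ u - 1 / 2 - k| ≤ ε := by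
    intro u v p hp
    refine hψ u v ⟨?_, p, hp⟩
    rintro rfl
    exact hodd _ p hp
  let η : V → V → ℝ := fun u v => ψ v - ψ u - 1 / 2 - round (ψ v - ψ u - 1 / 2)
  have hη : ∀ u v, ∃ k : ℤ, η u v = ψ v - ψ u - 1 / 2 - k := fun u v => ⟨_, rfl⟩
  have hedge : ∀ u v, H.Adj u v → |η u v| ≤ ε := by
    intro u v huv
    obtain ⟨q, hq⟩ := exists_walk_length_add (Walk.cons huv Walk.nil) (by simp) r
    obtain ⟨k, hk⟩ := hψ' u v q (by rw [hq]; simp; omega)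
    exact (round_le _ k).trans hk
  -- The sum of the two is an integer of size at most 2ε < 1.
  have hanti : ∀ u v, H.Adj u v → η v u = -η u v := by
    intro u v huv
    have h1 := hedge u v huv
    have h2 := hedge v u huv.symm
    obtain ⟨k, hk⟩ := hη u v
    obtain ⟨l, hl⟩ := hη v u
    rw [abs_le] at h1 h2
    have e : ((-1 - k - l : ℤ) : ℝ) = η u v + η v u := by rw [hk, hl]; push_cast; ring
    have d1 : ((-1 - k - l : ℤ) : ℝ) < 1 := by rw [e]; linarith
    have d2 : (-1 : ℝ) < ((-1 - k - l : ℤ) : ℝ) := by rw [e]; linarith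
    have d1' : -1 - k - l < 1 := by exact_mod_cast d1
    have d2' : -1 < -1 - k - l := by exact_mod_cast d2
    rw [show -1 - k - l = 0 by omega] at e
    push_cast at e
    linarith
  have hr : (0 : ℝ) < 2 * r + 1 := by positivity
  have hclosed : ∀ u (p : H.Walk u u),
      0 ≤ walkSum (fun x y => ε / (2 * r + 1) + η x y) p := by
    intro u p
    -- Repeated 2r+1 times, `p` splits into `p.length` blocks of length 2r+1, each of sum at most ε
    -- in size.
    obtain ⟨q, hq1, hq2⟩ := exists_closedWalk_iterate η p (2 * r + 1)
    have := abs_walkSum_le_mul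
      (fun u v p hp => abs_walkSum_le hε hη hedge hψ' r le_rfl p hp) p.length q
      (by rw [hq1]; ring)
    rw [hq2, abs_le] at this
    push_cast at this
    rw [walkSum_add_const, ← mul_div_assoc, div_add' _ _ _ hr.ne']
    apply div_nonneg _ hr.le
    linarith [this.1]
  obtain ⟨π, hπ⟩ := exists_potential H _ hclosed
  refine ⟨fun v => ψ v - π v, fun u v huv => ?_⟩
  obtain ⟨k, hk⟩ := hη u v
  have h1 := hπ u v huv
  have h2 := hπ v u huv.symm
  rw [hanti u v huv] at h2
  refine ⟨k, ?_⟩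
  rw [abs_le]
  constructor <;> linarith

/-! ### Subdivisions -/

theorem adj_out {V : Type*} (G : SimpleGraph V) (e : G.edgeSet) :
    G.Adj (Quot.out e.1).1 (Quot.out e.1).2 := by
  have h : s((Quot.out e.1).1, (Quot.out e.1).2) = e.1 := Quot.out_eq e.1
  rw [← mem_edgeSet, h]
  exact e.2

theorem pathVertex_ne_succ {V : Type*} (G : SimpleGraph V) {q : ℕ} (e : G.edgeSet) {i : ℕ}
    (hi : i < q) : pathVertex G q e i ≠ pathVertex G q e (i + 1) := by
  have := (adj_out G e).ne
  unfold pathVertex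
  split_ifs <;> simp_all; omega

theorem exists_walk_pathVertex {V : Type*} (G : SimpleGraph V) {q : ℕ} (e : G.edgeSet) (i : ℕ)
    (hi : i ≤ q) :
    ∃ p : (subdivision G q).Walk (pathVertex G q e 0) (pathVertex G q e i), p.length = i := by
  induction i with
  | zero => exact ⟨Walk.nil, rfl⟩
  | succ i ih =>
    obtain ⟨p, hp⟩ := ih (by omega)
    have hadj : (subdivision G q).Adj (pathVertex G q e i) (pathVertex G q e (i + 1)) := by
      rw [subdivision, fromRel_adj]
      exact ⟨pathVertex_ne_succ G e (by omega), Or.inl ⟨e, i, by omega, rfl, rfl⟩⟩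
    exact ⟨p.concat hadj, by rw [Walk.length_concat, hp]⟩

theorem pathVertex_zero {V : Type*} (G : SimpleGraph V) (q : ℕ) (e : G.edgeSet) :
    pathVertex G q e 0 = Sum.inl (Quot.out e.1).1 := by simp [pathVertex]

theorem pathVertex_self {V : Type*} (G : SimpleGraph V) {q : ℕ} (hq : 0 < q) (e : G.edgeSet) :
    pathVertex G q e q = Sum.inl (Quot.out e.1).2 := by simp [pathVertex, hq.ne']

theorem exists_walk_subdivision {V : Type*} {G : SimpleGraph V} {q : ℕ} (hq : 0 < q) {u v : V}
    (huv : G.Adj u v) :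
    ∃ p : (subdivision G q).Walk (Sum.inl u) (Sum.inl v), p.length = q := by
  let e : G.edgeSet := ⟨s(u, v), huv⟩
  obtain ⟨p, hp⟩ := exists_walk_pathVertex G e q le_rfl
  have h : s((Quot.out e.1).1, (Quot.out e.1).2) = s(u, v) := Quot.out_eq e.1
  have h0 := pathVertex_zero G q e
  have h1 := pathVertex_self G hq e
  rcases Sym2.eq_iff.1 h with ⟨ha, hb⟩ | ⟨ha, hb⟩
  · rw [ha] at h0
    rw [hb] at h1
    exact ⟨p.copy h0 h1, by simpa using hp⟩
  · rw [ha] at h0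
    rw [hb] at h1
    exact ⟨(p.copy h0 h1).reverse, by simpa using hp⟩

theorem CircColorable.of_subdivision {V : Type*} {G : SimpleGraph V} {δ : ℝ} {s : ℕ}
    (h : CircColorable (subdivision G (2 * s + 1)) δ) : CircColorable G ((2 * s + 1) * δ) := by
  obtain ⟨φ, hφ⟩ := h
  refine ⟨fun v => φ (Sum.inl v), fun u v huv => ?_⟩
  obtain ⟨p, hp⟩ := exists_walk_subdivision (q := 2 * s + 1) (by omega) huv
  exact antipodal_odd_walk hφ p hp

theorem CircColorable.subdivision {V : Type*} {G : SimpleGraph V} {δ : ℝ}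
    (h : CircColorable G δ) (s : ℕ) :
    CircColorable (subdivision G (2 * s + 1)) (δ / (2 * s + 1)) := by
  obtain ⟨φ, hφ⟩ := h
  have hq : (0 : ℝ) < 2 * s + 1 := by positivity
  choose k hk using fun e : G.edgeSet => hφ _ _ (adj_out G e)
  let η : G.edgeSet → ℝ := fun e => φ (Quot.out e.1).2 - φ (Quot.out e.1).1 - 1 / 2 - k e
  let c : G.edgeSet → ℕ → ℝ := fun e i =>
    φ (Quot.out e.1).1 + i * (1 / 2 + η e / (2 * s + 1))
  let Φ : SubdivVertex G (2 * s + 1) → ℝ := Sum.elim φ fun x => c x.1 (x.2 + 1)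
  have hΦ : ∀ e i, i ≤ 2 * s + 1 → ∃ m : ℤ, Φ (pathVertex G (2 * s + 1) e i) = c e i + m := by
    intro e i hi
    rcases Nat.eq_zero_or_pos i with rfl | hi0
    · exact ⟨0, by rw [pathVertex_zero]; simp [Φ, c]⟩
    rcases hi.lt_or_eq with hlt | rfl
    · refine ⟨0, ?_⟩
      rw [pathVertex, dif_neg hi0.ne', dif_pos hlt]
      simp only [Φ, Sum.elim_inr, Nat.sub_add_cancel hi0]
      simp
    -- The 2s+1 steps add up to s + 1/2 + `η e`, which is the edge's own increment up to an integer.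
    · refine ⟨k e - s, ?_⟩
      rw [pathVertex_self G hi0]
      simp only [Φ, Sum.elim_inl, c, η]
      push_cast
      field_simp
      ring
  have hstep : ∀ e i, i < 2 * s + 1 → ∃ m : ℤ,
      |Φ (pathVertex G (2 * s + 1) e (i + 1)) - Φ (pathVertex G (2 * s + 1) e i) - 1 / 2 - m| ≤
        δ / (2 * s + 1) := by
    intro e i hi
    obtain ⟨a, ha⟩ := hΦ e i hi.le
    obtain ⟨b, hb⟩ := hΦ e (i + 1) hi
    refine ⟨b - a, ?_⟩
    have : Φ (pathVertex G (2 * s + 1) e (i + 1)) - Φ (pathVertex G (2 * s + 1) e i) - 1 / 2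
        - ((b - a : ℤ) : ℝ) = η e / (2 * s + 1) := by
      rw [ha, hb]
      simp only [c]
      push_cast
      ring
    rw [this, abs_div, abs_of_pos hq]
    gcongr
    exact hk e
  refine ⟨Φ, fun x y hxy => ?_⟩
  rw [FracPow.subdivision, fromRel_adj] at hxy
  rcases hxy.2 with ⟨e, i, hi, rfl, rfl⟩ | ⟨e, i, hi, rfl, rfl⟩
  · exact hstep e i hi
  · exact antipodal_symm (hstep e i hi)

/-! ### The scaling law and the formula -/

/-- Fractional powers scale `1 / 2 - 1 / χ_c`. -/
theorem one_div_circularChromaticNumber_fracPower {V : Type*} [Finite V] (G : SimpleGraph V)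
    (r s : ℕ) (h : (2 * (r : ℝ) + 1) / (2 * s + 1) * (1 / 2 - 1 / circularChromaticNumber G) ≤
      1 / 6) :
    1 / circularChromaticNumber (fracPower G (2 * r + 1) (2 * s + 1)) =
      1 / 2 - (2 * (r : ℝ) + 1) / (2 * s + 1) * (1 / 2 - 1 / circularChromaticNumber G) := by
  set a : ℝ := (2 * (r : ℝ) + 1) / (2 * s + 1) with ha
  set D : ℝ := 1 / 2 - 1 / circularChromaticNumber G with hD
  have ha0 : 0 < a := by positivity
  have hr : (0 : ℝ) < 2 * r + 1 := by positivity
  have hs : (0 : ℝ) < 2 * s + 1 := by positivity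
  have h2 : 2 ≤ circularChromaticNumber G :=
    le_csInf (circularRatios_nonempty G) fun _ => two_le_of_mem_circularRatios
  have hD0 : 0 ≤ D := by
    have := one_div_le_one_div_of_le two_pos h2
    linarith
  have hup : ∀ ε > 0, CircColorable (fracPower G (2 * r + 1) (2 * s + 1)) (a * D + ε) := by
    intro ε hε
    have hlt : D < D + ε / a := by linarith [div_pos hε ha0]
    refine (((circColorable_of_gt G hlt).subdivision s).power r).mono (le_of_eq ?_)
    rw [ha]
    field_simp
  have haD : 0 ≤ a * D := by positivity
  apply le_antisymm
  · have hne : (circularRatios (fracPower G (2 * r + 1) (2 * s + 1))).Nonempty := by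
      obtain ⟨x, hx, -⟩ := (hup (1 / 6) (by norm_num)).exists_mem_circularRatios (by linarith)
        (by linarith) one_pos
      exact ⟨x, hx⟩
    -- `power` has no loops, so its colourings say nothing about closed walks of length 2r+1; these
    -- must be excluded separately.
    have hodd : ∀ u (p : (FracPow.subdivision G (2 * s + 1)).Walk u u),
        p.length ≠ 2 * r + 1 := by
      intro u p
      have hlt : D < D + 1 / 6 / a := by
        have : 0 < 1 / 6 / a := by positivity
        linarith
      refine ((circColorable_of_gt G hlt).subdivision s).length_ne ?_ p
      have : (2 * r + 1) * ((D + 1 / 6 / a) / (2 * s + 1)) = a * D + 1 / 6 := by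
        rw [ha]; field_simp
      rw [this]
      linarith
    rw [one_div_le (by
      have := le_csInf hne fun _ => two_le_of_mem_circularRatios
      exact two_pos.trans_le this) (by linarith)]
    refine le_csInf hne ?_
    rintro x ⟨n, d, hd, hn, ⟨f⟩, rfl⟩
    have hd0 : (0 : ℝ) < d := by exact_mod_cast hd
    have hn0 : (0 : ℝ) < n := by exact_mod_cast (by omega : 0 < n)
    rw [one_div_le (by linarith) (by positivity), one_div_div]
    -- If d/n ≤ 1/4, then `a * D ≤ 1/6` suffices; otherwise the error 1/2 - d/n is below 1/4, as
    -- `of_power` requires.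
    rcases le_or_gt ((d : ℝ) / n) (1 / 4) with h4 | h4
    · linarith
    have hd2 : (d : ℝ) / n ≤ 1 / 2 := by
      rw [div_le_iff₀ hn0]
      have : (2 * d : ℝ) ≤ n := by exact_mod_cast hn
      linarith
    have hcol := ((circColorable_of_hom hd hn f).of_power (by linarith) hodd).of_subdivision
    have hle := hcol.le_one_div (mul_nonneg hs.le (div_nonneg (by linarith) hr.le))
    have hle' : D ≤ (2 * s + 1) * ((1 / 2 - (d : ℝ) / n) / (2 * r + 1)) := by linarith
    have := mul_le_mul_of_nonneg_left hle' ha0.le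
    have e : a * ((2 * s + 1) * ((1 / 2 - (d : ℝ) / n) / (2 * r + 1))) = 1 / 2 - (d : ℝ) / n := by
      rw [ha]; field_simp
    rw [e] at this
    linarith
  · refine le_of_forall_pos_le_add fun ε hε => ?_
    have := (hup ε hε).le_one_div (by linarith)
    linarith

end FracPow

theorem mainTheorem2 {V : Type*} [Finite V] (G : SimpleGraph V) (hG : ¬ G.IsBipartite) (r s : ℕ)
    (h : (2 * (r : ℝ) + 1) / (2 * (s : ℝ) + 1) ≤
      FracPow.circularChromaticNumber G / (3 * (FracPow.circularChromaticNumber G - 2))) :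
    FracPow.circularChromaticNumber (FracPow.fracPower G (2 * r + 1) (2 * s + 1)) =
      (2 * (s : ℝ) + 1) * FracPow.circularChromaticNumber G /
        (((s : ℝ) - (r : ℝ)) * FracPow.circularChromaticNumber G + 2 * (r : ℝ) + 1) := by
  set c := FracPow.circularChromaticNumber G with hc
  have hs : (0 : ℝ) < 2 * s + 1 := by positivity
  have hr : (0 : ℝ) < 2 * r + 1 := by positivity
  have h2 : 2 ≤ c := le_csInf (FracPow.circularRatios_nonempty G)
    fun _ => FracPow.two_le_of_mem_circularRatios
  have hpos : 0 < (2 * (r : ℝ) + 1) / (2 * s + 1) := by positivity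
  have hc2 : 2 < c := by
    -- At `c = 2` the bound in `h` is a division by zero, with value 0, yet its left side is
    -- positive.
    refine lt_of_le_of_ne h2 fun h0 => ?_
    rw [← h0, sub_self, mul_zero, div_zero] at h
    linarith
  have hc0 : 0 < c := by linarith
  have hc3 : 0 < 3 * (c - 2) := by linarith
  have hle : (2 * (r : ℝ) + 1) / (2 * s + 1) * (1 / 2 - 1 / c) ≤ 1 / 6 := by
    rw [le_div_iff₀ hc3] at h
    have e : (2 * (r : ℝ) + 1) / (2 * s + 1) * (1 / 2 - 1 / c) =
        (2 * (r : ℝ) + 1) / (2 * s + 1) * (3 * (c - 2)) / (6 * c) := by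
      field_simp
      ring
    rw [e, div_le_iff₀ (by positivity)]
    linarith
  have key := FracPow.one_div_circularChromaticNumber_fracPower G r s hle
  rw [← hc] at key
  rw [← one_div_one_div (FracPow.circularChromaticNumber _), key]
  have e : 1 / 2 - (2 * (r : ℝ) + 1) / (2 * s + 1) * (1 / 2 - 1 / c) =
      (((s : ℝ) - r) * c + 2 * r + 1) / ((2 * s + 1) * c) := by
    field_simp
    ring
  rw [e, one_div_div]
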